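/- Let $k\ge 0$ and let $\Delta_k\subset\mathbb R^k$ be the canonical $k$-simplex, i.e. the convex hull of $e_0=0$ and the standard basis vectors $e_1,\dots,e_k$, regarded as a smooth manifold with corners. Let $\mathcal A$ be a transitive Lie algebroid on $\Delta_k$: a smooth real vector bundle of finite rank over $\Delta_k$ with a fibrewise surjective smooth vector bundle morphism $\gamma:\mathcal A\to T\Delta_k$ (the anchor) and a real Lie algebra structure on the space $\Gamma(\mathcal A)$ of smooth sections, such that $\gamma[\xi,\eta]=[\gamma\xi,\gamma\eta]$ and $[\xi,f\eta]=f[\xi,\eta]+(\gamma(\xi)\cdot f)\,\eta$ for all $\xi,\eta\in\Gamma(\mathcal A)$ and $f\in C^\infty(\Delta_k)$. For a (closed, nonempty) face $\alpha$ of $\Delta_k$, let $\mathcal A^{!!}_\alpha$ be the restriction of $\mathcal A$ to $\alpha$, whose fibre at $x\in\alpha$ is $\{a\in\mathcal A_x:\gamma(a)\in T_x\alpha\}$. A smooth $p$-form on $\mathcal A^{!!}_\alpha$ is a family, smooth in $x \in \alpha$, of alternating $p$-linear forms $(\mathcal A^{!!}_\alpha)_x^p\to\mathbb R$. For a subcomplex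 $K$ of the simplicial complex of all faces of $\Delta_k$, a piecewise smooth $p$-form on $K$ is a family $(\omega_\alpha)_{\alpha\in K}$ of smooth $p$-forms $\omega_\alpha$ on $\mathcal A^{!!}_\alpha$ such that, whenever $\alpha\subseteq\beta$ are faces in $K$, $x\in\alpha$ and $u_1,\dots,u_p\in(\mathcal A^{!!}_\alpha)_x$, one has $\omega_\alpha(x)(u_1,\dots,u_p)=\omega_\beta(x)(u_1,\dots,u_p)$. Let $\mathbf{bd}\,\Delta_k$ be the complex of all proper faces of $\Delta_k$. Proposition 3.1. For every $p\ge 0$ and every piecewise smooth $p$-form $\xi=(\xi_\alpha)_{\alpha\in\mathbf{bd}\,\Delta_k}$ on $\mathbf{bd}\,\Delta_k$ there is a piecewise smooth $p$-form $\omega=(\omega_\alpha)_\alpha$ on the complex of all faces of $\Delta_k$ such that $\omega_\alpha=\xi_\alpha$ for every $\alpha\in\mathbf{bd}\,\Delta_k$, i.e. $\omega_{/\mathbf{bd}\,\Delta_k}=\xi$. -/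

import Mathlib

open Set Function Bundle
open scoped Manifold ContDiff Topology

noncomputable section

/-! ### Lie algebroids -/

section LieAlgebroid

variable {V : Type*} [NormedAddCommGroup V] [NormedSpace ℝ V]
  {H : Type*} [TopologicalSpace H] (I : ModelWithCorners ℝ V H)
  {M : Type*} [TopologicalSpace M] [ChartedSpace H M] [IsManifold I ∞ M]
  (F : Type*) [NormedAddCommGroup F] [NormedSpace ℝ F]
  (E : M → Type*) [∀ x, AddCommGroup (E x)] [∀ x, Module ℝ (E x)]
  [∀ x, TopologicalSpace (E x)] [TopologicalSpace (TotalSpace F E)]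
  [FiberBundle F E] [VectorBundle ℝ F E]

/-- The product `f • s` of a smooth function and a smooth section. -/
def smoothSMul {I : ModelWithCorners ℝ V H} {F : Type*} [NormedAddCommGroup F] [NormedSpace ℝ F]
    {E : M → Type*} [∀ x, AddCommGroup (E x)] [∀ x, Module ℝ (E x)]
    [∀ x, TopologicalSpace (E x)] [TopologicalSpace (TotalSpace F E)]
    [FiberBundle F E] [VectorBundle ℝ F E]
    (f : C^∞⟮I, M; 𝓘(ℝ, ℝ), ℝ⟯) (s : Cₛ^∞⟮I; F, E⟯) : Cₛ^∞⟮I; F, E⟯ where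
  toFun x := f x • s x
  contMDiff_toFun := f.contMDiff.smul_section s.contMDiff

/-- A Lie algebroid structure on the vector bundle `E → M`: an anchor, which is a smooth vector
bundle morphism `E → TM`, and a real Lie algebra structure on the space of smooth sections of `E`,
such that the anchor is a homomorphism on sections and the Leibniz rule holds. -/
structure LieAlgebroid where
  /-- the anchor, fibre by fibre -/
  anchor : ∀ x : M, E x →ₗ[ℝ] TangentSpace I x
  /-- the anchor is smooth as a map of total spaces -/
  contMDiff_anchor : ContMDiff (I.prod 𝓘(ℝ, F)) I.tangent ∞
    (fun v : TotalSpace F E => (⟨v.proj, anchor v.proj v.snd⟩ : TangentBundle I M))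
  /-- the bracket of smooth sections -/
  bracket : Cₛ^∞⟮I; F, E⟯ →ₗ[ℝ] Cₛ^∞⟮I; F, E⟯ →ₗ[ℝ] Cₛ^∞⟮I; F, E⟯
  bracket_self : ∀ s, bracket s s = 0
  jacobi : ∀ s t u,
    bracket s (bracket t u) + bracket t (bracket u s) + bracket u (bracket s t) = 0
  anchor_bracket : ∀ (s t : Cₛ^∞⟮I; F, E⟯) (x : M),
    anchor x (bracket s t x) =
      VectorField.mlieBracket I (fun y => anchor y (s y)) (fun y => anchor y (t y)) x
  leibniz : ∀ (s t : Cₛ^∞⟮I; F, E⟯) (f : C^∞⟮I, M; 𝓘(ℝ, ℝ), ℝ⟯) (x : M),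
    bracket s (smoothSMul f t) x =
      f x • bracket s t x + mvfderiv I f x (anchor x (s x)) • t x

variable {I F E} in
/-- A Lie algebroid is transitive if its anchor is surjective. -/
def LieAlgebroid.IsTransitive (A : LieAlgebroid I F E) : Prop :=
  ∀ x : M, Surjective (A.anchor x)

end LieAlgebroid

/-! ### The canonical simplex as a manifold with corners -/

/-- The vertices `e₀ = 0` and `e₁, …, e_k` (the standard basis) of the canonical simplex. -/
def simplexVertex (k : ℕ) : Fin (k + 1) → (Fin k → ℝ) :=
  Fin.cons 0 (fun i => Pi.single i 1)

/-- The canonical `k`-simplex `Δ_k`, in its linear span `ℝ^k`. -/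
def canonicalSimplex (k : ℕ) : Set (Fin k → ℝ) :=
  convexHull ℝ (range (simplexVertex k))

theorem mem_canonicalSimplex_iff {k : ℕ} {x : Fin k → ℝ} :
    x ∈ canonicalSimplex k ↔ (∀ i, 0 ≤ x i) ∧ ∑ i, x i ≤ 1 := by
  constructor
  · intro hx
    have hc : Convex ℝ {y : Fin k → ℝ | (∀ i, 0 ≤ y i) ∧ ∑ i, y i ≤ 1} := by
      rintro y ⟨hy, hy'⟩ z ⟨hz, hz'⟩ a b ha hb hab
      refine ⟨fun i => ?_, ?_⟩
      · simp only [Pi.add_apply, Pi.smul_apply, smul_eq_mul]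
        exact add_nonneg (mul_nonneg ha (hy i)) (mul_nonneg hb (hz i))
      · simp only [Pi.add_apply, Pi.smul_apply, smul_eq_mul, Finset.sum_add_distrib,
          ← Finset.mul_sum]
        nlinarith
    refine convexHull_min ?_ hc hx
    rintro _ ⟨j, rfl⟩
    refine Fin.cases ?_ (fun i => ?_) j
    · simp [simplexVertex]
    · refine ⟨fun l => ?_, ?_⟩
      · simp only [simplexVertex, Fin.cons_succ, Pi.single_apply]
        split_ifs <;> simp
      · simp [simplexVertex]
  · rintro ⟨h0, h1⟩
    have key : (∑ j, (Fin.cons (1 - ∑ i, x i) x : Fin (k + 1) → ℝ) j • simplexVertex k j) = x := by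
      rw [Fin.sum_univ_succ]
      ext l
      simp [simplexVertex, Pi.single_apply]
    rw [← key]
    refine (convex_convexHull ℝ _).sum_mem (fun j _ => ?_) ?_ (fun j _ => ?_)
    · refine Fin.cases ?_ (fun i => ?_) j
      · simpa using h1
      · simpa using h0 i
    · rw [Fin.sum_univ_succ]
      simp
    · exact subset_convexHull ℝ _ ⟨j, rfl⟩

/-- A continuous retraction of `ℝ^k` onto the simplex (only needed as the inverse map
in `simplexModel`; nothing depends on which retraction it is). -/
def simplexRetraction (k : ℕ) (x : Fin k → ℝ) : Fin k → ℝ :=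
  fun i => max (x i) 0 / max 1 (∑ j, max (x j) 0)

theorem simplexRetraction_mem {k : ℕ} (x : Fin k → ℝ) :
    simplexRetraction k x ∈ canonicalSimplex k := by
  have hpos : (0 : ℝ) < max 1 (∑ j, max (x j) 0) := lt_max_of_lt_left one_pos
  rw [mem_canonicalSimplex_iff]
  refine ⟨fun i => div_nonneg (le_max_right _ _) hpos.le, ?_⟩
  simp only [simplexRetraction]
  rw [← Finset.sum_div, div_le_one hpos]
  exact le_max_right _ _

theorem simplexRetraction_eq {k : ℕ} {x : Fin k → ℝ} (hx : x ∈ canonicalSimplex k) :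
    simplexRetraction k x = x := by
  rw [mem_canonicalSimplex_iff] at hx
  have h : ∀ i, max (x i) 0 = x i := fun i => max_eq_left (hx.1 i)
  ext i
  simp [simplexRetraction, h, max_eq_left hx.2]

theorem continuous_simplexRetraction (k : ℕ) : Continuous (simplexRetraction k) := by
  refine continuous_pi fun i => Continuous.div ?_ ?_ fun x => ?_
  · fun_prop
  · fun_prop
  · exact (lt_max_of_lt_left one_pos).ne'

theorem interior_canonicalSimplex_nonempty (k : ℕ) : (interior (canonicalSimplex k)).Nonempty := by
  have hopen : IsOpen {x : Fin k → ℝ | (∀ i, 0 < x i) ∧ ∑ i, x i < 1} := by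
    apply IsOpen.inter
    · have : {x : Fin k → ℝ | ∀ i, 0 < x i} = ⋂ i, {x | 0 < x i} := by ext; simp
      have h : IsOpen {x : Fin k → ℝ | ∀ i, 0 < x i} := by
        rw [this]
        exact isOpen_iInter_of_finite fun i => isOpen_lt continuous_const (continuous_apply i)
      exact h
    · exact isOpen_lt (continuous_finsetSum _ fun i _ => continuous_apply i) continuous_const
  refine ⟨fun _ => 1 / ((k : ℝ) + 1), interior_maximal ?_ hopen ⟨fun i => by positivity, ?_⟩⟩
  · rintro x ⟨h0, h1⟩
    exact mem_canonicalSimplex_iff.2 ⟨fun i => (h0 i).le, h1.le⟩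
  · have : (0 : ℝ) < (k : ℝ) + 1 := by positivity
    simp only [Finset.sum_const, Finset.card_univ, Fintype.card_fin, nsmul_eq_mul]
    rw [mul_one_div, div_lt_one this]
    linarith

/-- The manifold-with-corners structure of `Δ_k`: the simplex is a convex body in `ℝ^k`, and the
inclusion `Δ_k ⊆ ℝ^k` serves as its single (global) chart. Hence smooth functions on `Δ_k` are the
functions that are smooth in the coordinates of `ℝ^k` up to the boundary, and every tangent space
is `ℝ^k`. -/
def simplexModel (k : ℕ) : ModelWithCorners ℝ (Fin k → ℝ) (canonicalSimplex k) :=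
  ModelWithCorners.ofConvexRange
    { toFun := Subtype.val
      invFun := fun x => ⟨simplexRetraction k x, simplexRetraction_mem x⟩
      source := univ
      target := canonicalSimplex k
      map_source' := fun x _ => x.2
      map_target' := fun _ _ => mem_univ _
      left_inv' := fun x _ => Subtype.ext (simplexRetraction_eq x.2)
      right_inv' := fun _ hx => simplexRetraction_eq hx }
    rfl (convex_convexHull ℝ _) continuous_subtype_val
    ((continuous_simplexRetraction k).subtype_mk _)
    (interior_canonicalSimplex_nonempty k)

/-- The (closed) face of `Δ_k` spanned by the vertices `e_j`, `j ∈ α`. -/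
def simplexFace {k : ℕ} (α : Finset (Fin (k + 1))) : Set (canonicalSimplex k) :=
  {x | (x : Fin k → ℝ) ∈ convexHull ℝ (simplexVertex k '' α)}

/-- The tangent space of the face spanned by `α` (the same at each of its points), as a subspace
of the tangent space `ℝ^k` of `Δ_k`. -/
def faceTangent {k : ℕ} (α : Finset (Fin (k + 1))) (x : canonicalSimplex k) :
    Submodule ℝ (TangentSpace (simplexModel k) x) :=
  (vectorSpan ℝ (simplexVertex k '' α) : Submodule ℝ (Fin k → ℝ))

/-- The boundary complex of `Δ_k`: all proper (nonempty) faces. The complex of all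
faces of `Δ_k` is `⊤`. -/
def boundaryComplex (k : ℕ) : PreAbstractSimplicialComplex (Fin (k + 1)) where
  faces := {α | α.Nonempty ∧ α ≠ Finset.univ}
  isRelLowerSet_faces := by
    rintro α ⟨hα, hα'⟩
    refine ⟨hα, fun β hβ hne => ⟨hne, ?_⟩⟩
    rintro rfl
    exact hα' (Finset.univ_subset_iff.1 hβ)

/-! ### Restriction of a Lie algebroid to the faces, and piecewise smooth forms -/

section Forms

variable {k : ℕ} {F : Type*} [NormedAddCommGroup F] [NormedSpace ℝ F]
  {E : canonicalSimplex k → Type*} [∀ x, AddCommGroup (E x)] [∀ x, Module ℝ (E x)]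
  [∀ x, TopologicalSpace (E x)] [TopologicalSpace (TotalSpace F E)]
  [FiberBundle F E] [VectorBundle ℝ F E]

/-- The fibre at `x` of the restriction `A^!!_α` of `A` to the face `α`: the vectors of the fibre
of `A` at `x` whose anchor is tangent to the face. (It is used only at points `x` of the face.) -/
def LieAlgebroid.restrictFiber (A : LieAlgebroid (simplexModel k) F E)
    (α : Finset (Fin (k + 1))) (x : canonicalSimplex k) : Submodule ℝ (E x) :=
  (faceTangent α x).comap (A.anchor x)

/-- A smooth form of degree `p` on the restriction `A^!!_α`: an alternating `p`-linear form on the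
fibre of `A^!!_α` at each point of the face, such that its value on any `p` smooth local sections
of `A^!!_α` is a smooth function. Local sections are sections over the open subsets `U ∩ α` of the
face (their values elsewhere are irrelevant). Since the face is a convex body in its affine
span, `ContMDiffOn` on `U ∩ α` is the same as smoothness on the manifold with corners `α`. -/
@[ext]
structure SmoothFaceForm (A : LieAlgebroid (simplexModel k) F E) (p : ℕ)
    (α : Finset (Fin (k + 1))) where
  toFun : ∀ x : simplexFace α, A.restrictFiber α x [⋀^Fin p]→ₗ[ℝ] ℝ
  smooth : ∀ (U : Set (canonicalSimplex k)), IsOpen U →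
    ∀ s : Fin p → ∀ x : canonicalSimplex k, A.restrictFiber α x,
      (∀ i, ContMDiffOn (simplexModel k) ((simplexModel k).prod 𝓘(ℝ, F)) ∞
        (fun x => (⟨x, (s i x : E x)⟩ : TotalSpace F E)) (U ∩ simplexFace α)) →
      ∀ g : canonicalSimplex k → ℝ,
        (∀ x : simplexFace α, (x : canonicalSimplex k) ∈ U → g x = toFun x (fun i => s i x)) →
        ContMDiffOn (simplexModel k) 𝓘(ℝ, ℝ) ∞ g (U ∩ simplexFace α)

theorem LieAlgebroid.restrictFiber_mono (A : LieAlgebroid (simplexModel k) F E)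
    {α β : Finset (Fin (k + 1))} (h : α ⊆ β) (x : canonicalSimplex k) :
    A.restrictFiber α x ≤ A.restrictFiber β x :=
  Submodule.comap_mono (vectorSpan_mono ℝ (image_mono h))

theorem simplexFace_mono {α β : Finset (Fin (k + 1))} (h : α ⊆ β) :
    simplexFace α ⊆ simplexFace β :=
  fun _ hx => convexHull_mono (image_mono h) hx

/-- A piecewise smooth form of degree `p` on the complex of Lie algebroids `{A^!!_α}`, `α ∈ K`,
where `K` is a complex of faces of `Δ_k`: a family of smooth forms `η_α` on the `A^!!_α` such that
`η_β` restricts to `η_α` whenever `α` is a face of `β`. -/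
@[ext]
structure PiecewiseSmoothForm (A : LieAlgebroid (simplexModel k) F E) (p : ℕ)
    (K : PreAbstractSimplicialComplex (Fin (k + 1))) where
  form : ∀ α, α ∈ K → SmoothFaceForm A p α
  compatible : ∀ (α β : Finset (Fin (k + 1))) (hα : α ∈ K) (hβ : β ∈ K) (h : α ⊆ β)
    (x : simplexFace α) (u : Fin p → A.restrictFiber α x),
    (form α hα).toFun x u =
      (form β hβ).toFun ⟨x, simplexFace_mono h x.2⟩
        (fun i => Submodule.inclusion (A.restrictFiber_mono h x) (u i))

/-- The restriction of a piecewise smooth form to a subcomplex. -/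
def PiecewiseSmoothForm.restrict {A : LieAlgebroid (simplexModel k) F E} {p : ℕ}
    {K L : PreAbstractSimplicialComplex (Fin (k + 1))} (η : PiecewiseSmoothForm A p K)
    (hL : L ≤ K) : PiecewiseSmoothForm A p L where
  form α hα := η.form α (hL hα)
  compatible α β hα hβ h x u := η.compatible α β (hL hα) (hL hβ) h x u

end Forms

end

noncomputable section

/-! ### Simplicial self-maps of the simplex -/

/-! The problem is local: extensions near points are glued by a partition of unity, because agreeing
with `ξ` on the boundary is an affine condition on a form.

Near `x₀`, transitivity gives a frame `A ≅ ℝ^k × L` in which the anchor is the first projection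
(`exists_anchorFrame`). An affine self-map of the simplex then lifts to `A` as its linear part times
the identity of `L`. Let `J` be the set of vertices whose barycentric coordinate vanishes at `x₀`,
and fix `i₀ ∉ J`. For `S ⊆ J`, the simplicial map `r_S` that collapses `S` to `i₀` fixes `x₀` and
sends the simplex into the face `Sᶜ`, so for nonempty `S` the pullback `r_S^* ξ_{Sᶜ}` is a smooth
form near `x₀` (`contMDiffAt_pullback`). The local extension is the inclusion-exclusion sum `-∑
(-1)^|S| r_S^* ξ_{Sᶜ}` over nonempty `S ⊆ J`.

On a face that misses some `j ∈ J`, the maps `r_S` and `r_{S ∪ {j}}` coincide, so the terms of `S`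
and `S ∪ {j}` cancel by compatibility of `ξ`. Only `S = {j}` survives, and `r_{j}` is the identity
there, which leaves `ξ` (`boundaryExtension_apply`). -/

/-- The barycentric coordinates with respect to the vertices of `Δ_k`. -/
def baryCoord {k : ℕ} (x : Fin k → ℝ) : Fin (k + 1) → ℝ :=
  Fin.cons (1 - ∑ i, x i) x

theorem sum_baryCoord {k : ℕ} (x : Fin k → ℝ) : ∑ j, baryCoord x j = 1 := by
  simp [baryCoord, Fin.sum_univ_succ]

/-- The affine map of `ℝ^k` that sends the vertex `e_j` of `Δ_k` to `e_{r j}`. -/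
def vertexMap {k : ℕ} (r : Fin (k + 1) → Fin (k + 1)) : (Fin k → ℝ) →ᵃ[ℝ] (Fin k → ℝ) :=
  (∑ i, (LinearMap.proj i : (Fin k → ℝ) →ₗ[ℝ] ℝ).smulRight
      (simplexVertex k (r i.succ) - simplexVertex k (r 0))).toAffineMap +
    AffineMap.const ℝ _ (simplexVertex k (r 0))

theorem vertexMap_apply {k : ℕ} (r : Fin (k + 1) → Fin (k + 1)) (x : Fin k → ℝ) :
    vertexMap r x = ∑ j, baryCoord x j • simplexVertex k (r j) := by
  simp only [vertexMap, AffineMap.coe_add, LinearMap.coe_toAffineMap, AffineMap.coe_const,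
    LinearMap.sum_apply, LinearMap.smulRight_apply, LinearMap.proj_apply, Function.const_apply,
    Pi.add_apply, baryCoord, Fin.sum_univ_succ, Fin.cons_zero, Fin.cons_succ, smul_sub,
    Finset.sum_sub_distrib, sub_smul, Finset.sum_smul, one_smul]
  abel

theorem vertexMap_vertex {k : ℕ} (r : Fin (k + 1) → Fin (k + 1)) (j : Fin (k + 1)) :
    vertexMap r (simplexVertex k j) = simplexVertex k (r j) := by
  have h : baryCoord (simplexVertex k j) = Pi.single j 1 := by
    refine Fin.cases ?_ (fun i => ?_) j <;> ext l <;> refine Fin.cases ?_ (fun l => ?_) l <;>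
      simp [baryCoord, simplexVertex, Pi.single_apply, Fin.succ_ne_zero, eq_comm]
  rw [vertexMap_apply, h]
  simp [Pi.single_apply]

theorem vertexMap_id {k : ℕ} (x : Fin k → ℝ) : vertexMap id x = x := by
  rw [vertexMap_apply, Fin.sum_univ_succ]
  ext l
  simp [baryCoord, simplexVertex, Pi.single_apply]

/-- Vanishing of one barycentric coordinate is a convex condition, so it suffices to test it on the
vertices of the face. -/
theorem baryCoord_eq_zero {k : ℕ} {α : Finset (Fin (k + 1))} {x : Fin k → ℝ}
    (hx : x ∈ convexHull ℝ (simplexVertex k '' α)) {j : Fin (k + 1)} (hj : j ∉ α) :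
    baryCoord x j = 0 := by
  have hc : Convex ℝ {y : Fin k → ℝ | baryCoord y j = 0} := by
    rintro y hy z hz a b - - hab
    simp only [mem_ofPred_eq] at *
    have : baryCoord (a • y + b • z) j = a * baryCoord y j + b * baryCoord z j := by
      refine Fin.cases ?_ (fun i => ?_) j
      · simp only [baryCoord, Fin.cons_zero, Pi.add_apply, Pi.smul_apply, smul_eq_mul,
          Finset.sum_add_distrib, ← Finset.mul_sum]
        linear_combination -hab
      · simp [baryCoord]
    rw [this, hy, hz]
    simp
  refine convexHull_min ?_ hc hx
  rintro _ ⟨i, hi, rfl⟩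
  have hij : i ≠ j := fun h => hj (h ▸ hi)
  revert hij
  simp only [mem_ofPred_eq]
  refine Fin.cases ?_ (fun i => ?_) i <;> refine Fin.cases ?_ (fun j => ?_) j <;>
    simp +contextual [baryCoord, simplexVertex, Pi.single_apply, eq_comm]

theorem vertexMap_mapsTo {k : ℕ} {r : Fin (k + 1) → Fin (k + 1)}
    {α β : Finset (Fin (k + 1))} (hr : MapsTo r α β) :
    MapsTo (vertexMap r) (convexHull ℝ (simplexVertex k '' α))
      (convexHull ℝ (simplexVertex k '' β)) := by
  intro x hx
  have := mem_image_of_mem (vertexMap r) hx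
  rw [AffineMap.image_convexHull] at this
  refine convexHull_mono ?_ this
  rintro _ ⟨_, ⟨i, hi, rfl⟩, rfl⟩
  exact ⟨r i, hr hi, (vertexMap_vertex r i).symm⟩

theorem vertexMap_linear_mapsTo {k : ℕ} {r : Fin (k + 1) → Fin (k + 1)}
    {α β : Finset (Fin (k + 1))} (hr : MapsTo r α β) {v : Fin k → ℝ}
    (hv : v ∈ vectorSpan ℝ (simplexVertex k '' α)) :
    (vertexMap r).linear v ∈ vectorSpan ℝ (simplexVertex k '' β) := by
  have := Submodule.mem_map_of_mem (f := (vertexMap r).linear) hv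
  rw [AffineMap.map_vectorSpan] at this
  refine vectorSpan_mono ℝ ?_ this
  rintro _ ⟨_, ⟨i, hi, rfl⟩, rfl⟩
  exact ⟨r i, hr hi, (vertexMap_vertex r i).symm⟩

theorem vertexMap_eqOn {k : ℕ} {r r' : Fin (k + 1) → Fin (k + 1)}
    {α : Finset (Fin (k + 1))} (hr : EqOn r r' α) :
    EqOn (vertexMap r) (vertexMap r') (convexHull ℝ (simplexVertex k '' α)) := by
  intro x hx
  rw [vertexMap_apply, vertexMap_apply]
  refine Finset.sum_congr rfl fun j _ => ?_
  by_cases hj : j ∈ α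
  · rw [hr hj]
  · rw [baryCoord_eq_zero hx hj, zero_smul, zero_smul]

theorem vertexMap_linear_eqOn {k : ℕ} {r r' : Fin (k + 1) → Fin (k + 1)}
    {α : Finset (Fin (k + 1))} (hr : EqOn r r' α) :
    EqOn (vertexMap r).linear (vertexMap r').linear
      (vectorSpan ℝ (simplexVertex k '' (α : Set (Fin (k + 1))))) := by
  refine LinearMap.eqOn_span ?_
  rintro _ ⟨_, ⟨i, hi, rfl⟩, _, ⟨j, hj, rfl⟩, rfl⟩
  simp only [AffineMap.linearMap_vsub, vertexMap_vertex, hr hi, hr hj]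

theorem vertexMap_id_linear {k : ℕ} (v : Fin k → ℝ) : (vertexMap id).linear v = v := by
  have : (vertexMap id : (Fin k → ℝ) →ᵃ[ℝ] (Fin k → ℝ)) = AffineMap.id ℝ _ :=
    AffineMap.ext vertexMap_id
  rw [this]
  rfl

theorem simplexFace_univ {k : ℕ} : (simplexFace Finset.univ : Set (canonicalSimplex k)) = univ := by
  ext x
  simp [simplexFace, canonicalSimplex]

theorem isClosed_simplexFace {k : ℕ} (α : Finset (Fin (k + 1))) : IsClosed (simplexFace (k := k) α) :=
  (((α.finite_toSet.image _).isCompact_convexHull ℝ).isClosed).preimage continuous_subtype_val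

theorem vectorSpan_simplexVertex_univ (k : ℕ) : vectorSpan ℝ (range (simplexVertex k)) = ⊤ := by
  refine eq_top_iff.2 fun v _ => ?_
  rw [← Finset.univ_sum_single v]
  refine Submodule.sum_mem _ fun i _ => ?_
  have : (Pi.single i (v i) : Fin k → ℝ) =
      v i • (simplexVertex k i.succ -ᵥ simplexVertex k 0) := by
    ext l
    simp [simplexVertex, Pi.single_apply]
  rw [this]
  exact Submodule.smul_mem _ _ (vsub_mem_vectorSpan ℝ ⟨_, rfl⟩ ⟨_, rfl⟩)

/-- The simplicial self-map of `Δ_k` that sends `e_j` to `e_{r j}`. -/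
def simplicialMap {k : ℕ} (r : Fin (k + 1) → Fin (k + 1)) (x : canonicalSimplex k) :
    canonicalSimplex k :=
  ⟨vertexMap r x, by
    have h : MapsTo r (Finset.univ : Finset (Fin (k + 1))) (Finset.univ : Finset (Fin (k + 1))) :=
      fun _ _ => by simp
    simpa [canonicalSimplex] using
      vertexMap_mapsTo h (x := x) (by simpa [canonicalSimplex] using x.2)⟩

theorem simplicialMap_mem_face {k : ℕ} {r : Fin (k + 1) → Fin (k + 1)}
    {α β : Finset (Fin (k + 1))} (hr : MapsTo r α β) {x : canonicalSimplex k}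
    (hx : x ∈ simplexFace α) : simplicialMap r x ∈ simplexFace β :=
  vertexMap_mapsTo hr hx

theorem contMDiff_simplicialMap {k : ℕ} (r : Fin (k + 1) → Fin (k + 1)) :
    ContMDiff (simplexModel k) (simplexModel k) ∞ (simplicialMap r) := by
  have hc : Continuous (vertexMap r) := (vertexMap r).continuous_of_finiteDimensional
  have hs : ContDiff ℝ ∞ (vertexMap r) := by
    -- An affine map is its linear part plus a constant.
    have : ⇑(vertexMap r) = fun x => (vertexMap r).linear.toContinuousLinearMap x + vertexMap r 0 := by
      ext x : 1
      simpa using congrFun (vertexMap r).decomp x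
    rw [this]
    exact (ContinuousLinearMap.contDiff _).add contDiff_const
  intro x
  rw [← contMDiffWithinAt_univ, contMDiffWithinAt_iff]
  refine ⟨((hc.comp continuous_subtype_val).subtype_mk _).continuousWithinAt, ?_⟩
  refine (hs.contDiffAt.contDiffWithinAt).congr ?_ ?_
  · rintro y ⟨-, z, rfl⟩
    simp [extChartAt]
    rfl
  · simp [extChartAt]
    rfl

end

noncomputable section

/-! ### Local frames adapted to the anchor -/

section Frame

variable {k : ℕ} {F : Type*} [NormedAddCommGroup F] [NormedSpace ℝ F]
  {E : canonicalSimplex k → Type*} [∀ x, AddCommGroup (E x)] [∀ x, Module ℝ (E x)]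
  [∀ x, TopologicalSpace (E x)] [TopologicalSpace (TotalSpace F E)]
  [FiberBundle F E] [VectorBundle ℝ F E]

/-- The anchor, with values in the model space `ℝ^k` of all tangent spaces of `Δ_k`. -/
def LieAlgebroid.anchorVec (A : LieAlgebroid (simplexModel k) F E) (x : canonicalSimplex k) :
    E x →ₗ[ℝ] (Fin k → ℝ) :=
  A.anchor x

/-- The simplex is its own model space, so the canonical trivialization of its tangent bundle is the
identity on fibres. -/
theorem LieAlgebroid.contMDiffAt_anchorVec (A : LieAlgebroid (simplexModel k) F E)
    {s : ∀ x, E x} {x : canonicalSimplex k}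
    (hs : ContMDiffAt (simplexModel k) ((simplexModel k).prod 𝓘(ℝ, F)) ∞
      (fun y => (⟨y, s y⟩ : TotalSpace F E)) x) :
    ContMDiffAt (simplexModel k) 𝓘(ℝ, Fin k → ℝ) ∞ (fun y => A.anchorVec y (s y)) x := by
  have h1 := (A.contMDiff_anchor _).comp x hs
  have h2 := (Bundle.contMDiffAt_totalSpace.1 h1).2
  simp only [trivializationAt_model_space_apply] at h2
  exact h2

/-- A local trivialization of `E` over `U`, with typical fibre `ℝ^k × L`, in which the anchor is
the first projection. -/
structure AnchorFrame (A : LieAlgebroid (simplexModel k) F E) (L : Submodule ℝ F)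
    (U : Set (canonicalSimplex k)) where
  /-- the vectors of the frame -/
  vec : ∀ y, ((Fin k → ℝ) × L) →ₗ[ℝ] E y
  /-- the coordinates in the frame -/
  coord : ∀ y, E y →ₗ[ℝ] (Fin k → ℝ) × L
  coord_vec : ∀ y ∈ U, ∀ w, coord y (vec y w) = w
  vec_coord : ∀ y ∈ U, ∀ u, vec y (coord y u) = u
  coord_fst : ∀ y ∈ U, ∀ u, (coord y u).1 = A.anchorVec y u
  contMDiffOn_vec : ∀ w, ContMDiffOn (simplexModel k) ((simplexModel k).prod 𝓘(ℝ, F)) ∞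
    (fun y => (⟨y, vec y w⟩ : TotalSpace F E)) U
  contMDiffAt_coord : ∀ (s : ∀ y, E y), ∀ y ∈ U,
    ContMDiffAt (simplexModel k) ((simplexModel k).prod 𝓘(ℝ, F)) ∞
      (fun z => (⟨z, s z⟩ : TotalSpace F E)) y →
    ContMDiffAt (simplexModel k) 𝓘(ℝ, (Fin k → ℝ) × L) ∞ (fun z => coord z (s z)) y

theorem AnchorFrame.anchor_vec {A : LieAlgebroid (simplexModel k) F E} {L : Submodule ℝ F}
    {U : Set (canonicalSimplex k)} (Φ : AnchorFrame A L U) {y : canonicalSimplex k} (hy : y ∈ U)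
    (w : (Fin k → ℝ) × L) : A.anchorVec y (Φ.vec y w) = w.1 := by
  rw [← Φ.coord_fst y hy, Φ.coord_vec y hy]

/-- In finite dimension an operator is a fixed linear expression in its values on a basis. -/
theorem contMDiffAt_clm_of_apply {V H M F G : Type*} [NormedAddCommGroup V] [NormedSpace ℝ V]
    [TopologicalSpace H] {I : ModelWithCorners ℝ V H} [TopologicalSpace M] [ChartedSpace H M]
    [NormedAddCommGroup F] [NormedSpace ℝ F] [FiniteDimensional ℝ F]
    [NormedAddCommGroup G] [NormedSpace ℝ G] {T : M → F →L[ℝ] G} {x : M}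
    (h : ∀ v, ContMDiffAt I 𝓘(ℝ, G) ∞ (fun y => T y v) x) :
    ContMDiffAt I 𝓘(ℝ, F →L[ℝ] G) ∞ T x := by
  let b := Module.finBasis ℝ F
  have hT : T = fun y => ∑ i,
      ContinuousLinearMap.smulRightL ℝ F G (b.coord i).toContinuousLinearMap (T y (b i)) := by
    ext y v
    conv_lhs => rw [← b.sum_repr v]
    simp [-Module.Basis.sum_repr]
  rw [hT]
  exact ContMDiffAt.sum fun i _ =>
    ((ContinuousLinearMap.contMDiff _).contMDiffAt).comp x (h (b i))

/-- In a trivialization at `x₀`, pair the anchor with a fixed projection `q` onto its kernel `L` at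
`x₀`. By transitivity the resulting map `F → ℝ^k × L` is invertible at `x₀`, hence on a
neighbourhood, and its inverse depends smoothly on the point. -/
theorem exists_anchorFrame [FiniteDimensional ℝ F] [ContMDiffVectorBundle ∞ F E (simplexModel k)]
    (A : LieAlgebroid (simplexModel k) F E) (hA : A.IsTransitive) (x₀ : canonicalSimplex k) :
    ∃ (L : Submodule ℝ F) (U : Set (canonicalSimplex k)),
      IsOpen U ∧ x₀ ∈ U ∧ Nonempty (AnchorFrame A L U) := by
  let e := trivializationAt F E x₀
  let a : ∀ y, F →ₗ[ℝ] (Fin k → ℝ) := fun y => A.anchorVec y ∘ₗ e.symmₗ ℝ y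
  let L : Submodule ℝ F := LinearMap.ker (a x₀)
  obtain ⟨q, hq⟩ := L.subtype.exists_leftInverse_of_injective L.ker_subtype
  let T : canonicalSimplex k → F →L[ℝ] (Fin k → ℝ) × L :=
    fun y => LinearMap.toContinuousLinearMap ((a y).prod q)
  have hx₀ : x₀ ∈ e.baseSet := mem_baseSet_trivializationAt F E x₀
  have hvec : ∀ {n : canonicalSimplex k → F} {y}, y ∈ e.baseSet →
      ContMDiffAt (simplexModel k) 𝓘(ℝ, F) ∞ n y →
      ContMDiffAt (simplexModel k) ((simplexModel k).prod 𝓘(ℝ, F)) ∞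
        (fun z => (⟨z, e.symmₗ ℝ z (n z)⟩ : TotalSpace F E)) y := by
    intro n y hy hn
    rw [e.contMDiffAt_section_iff hy]
    refine hn.congr_of_eventuallyEq ?_
    filter_upwards [e.open_baseSet.mem_nhds hy] with z hz
    rw [e.symmₗ_apply hz, e.apply_mk_symm hz]
  have hTs : ∀ y ∈ e.baseSet,
      ContMDiffAt (simplexModel k) 𝓘(ℝ, F →L[ℝ] (Fin k → ℝ) × L) ∞ T y := by
    intro y hy
    refine contMDiffAt_clm_of_apply fun v => ?_
    exact (A.contMDiffAt_anchorVec (hvec hy contMDiffAt_const)).prodMk_space contMDiffAt_const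
  have hbij : Bijective (T x₀) := by
    constructor
    · refine (injective_iff_map_eq_zero _).2 fun v hv => ?_
      have h1 : a x₀ v = 0 := congrArg Prod.fst hv
      have h2 : q v = 0 := congrArg Prod.snd hv
      have h3 : q v = ⟨v, h1⟩ := LinearMap.congr_fun hq ⟨v, h1⟩
      exact congrArg Subtype.val (h3.symm.trans h2)
    · rintro ⟨v, l⟩
      obtain ⟨u, hu⟩ := hA x₀ v
      let f := e.linearMapAt ℝ x₀ u
      have hf : a x₀ f = v := by
        simp only [a, f, LinearMap.comp_apply]
        rw [e.symmₗ_linearMapAt hx₀]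
        exact hu
      -- The anchor at `x₀` kills `q f` and `l`, while `q` is the identity on `L`.
      refine ⟨f - q f + l, Prod.ext ?_ ?_⟩
      · change a x₀ (f - q f + l) = v
        rw [map_add, map_sub, hf, LinearMap.mem_ker.1 (q f).2, LinearMap.mem_ker.1 l.2]
        simp
      · change q (f - q f + l) = l
        have h (l : L) : q l = l := LinearMap.congr_fun hq l
        rw [map_add, map_sub, h, h]
        simp
  let T₀ : F ≃L[ℝ] (Fin k → ℝ) × L :=
    (LinearEquiv.ofBijective (T x₀ : F →ₗ[ℝ] (Fin k → ℝ) × L) hbij).toContinuousLinearEquiv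
  let U := e.baseSet ∩ T ⁻¹' range ((↑) : (F ≃L[ℝ] (Fin k → ℝ) × L) → _)
  have hUo : IsOpen U := ContinuousOn.isOpen_inter_preimage
    (fun y hy => (hTs y hy).continuousAt.continuousWithinAt) e.open_baseSet ContinuousLinearEquiv.isOpen
  have hN : ∀ y ∈ U, ∀ w, ContMDiffAt (simplexModel k) 𝓘(ℝ, F) ∞ (fun z => (T z).inverse w) y := by
    rintro y ⟨hy, T', hT'⟩ w
    have h1 : ContDiffAt ℝ ∞ ContinuousLinearMap.inverse (T y) := hT' ▸ contDiffAt_map_inverse T'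
    have h2 := h1.contMDiffAt.comp y (hTs y hy)
    exact h2.clm_apply contMDiffAt_const
  have hsymm : ∀ y ∈ U, ∀ u : E y,
      A.anchorVec y u = a y (e.linearMapAt ℝ y u) := by
    intro y hy u
    simp only [a, LinearMap.comp_apply]
    rw [e.symmₗ_linearMapAt hy.1]
  refine ⟨L, U, hUo, ⟨hx₀, T₀, ?_⟩, ⟨{
    vec := fun y => e.symmₗ ℝ y ∘ₗ (T y).inverse
    coord := fun y => (T y : F →ₗ[ℝ] (Fin k → ℝ) × L) ∘ₗ e.linearMapAt ℝ y
    coord_vec := ?_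
    vec_coord := ?_
    coord_fst := fun y hy u => (hsymm y hy u).symm
    contMDiffOn_vec := fun w y hy => (hvec hy.1 (hN y hy w)).contMDiffWithinAt
    contMDiffAt_coord := ?_ }⟩⟩
  · ext v : 1
    rfl
  · rintro y ⟨hy, T', hT'⟩ w
    simp only [LinearMap.comp_apply, ContinuousLinearMap.coe_coe]
    rw [e.linearMapAt_symmₗ hy]
    simp [← hT']
  · rintro y ⟨hy, T', hT'⟩ u
    simp only [LinearMap.comp_apply, ContinuousLinearMap.coe_coe]
    rw [← hT']
    simpa using e.symmₗ_linearMapAt hy u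
  · intro s y hy hs
    rw [e.contMDiffAt_section_iff hy.1] at hs
    refine ((hTs y hy.1).clm_apply hs).congr_of_eventuallyEq ?_
    filter_upwards [e.open_baseSet.mem_nhds hy.1] with z hz
    simp [hz]

end Frame

end

noncomputable section

/-! ### Forms on faces and their pullbacks -/

section Pullback

variable {k : ℕ} {F : Type*} [NormedAddCommGroup F] [NormedSpace ℝ F]
  {E : canonicalSimplex k → Type*} [∀ x, AddCommGroup (E x)] [∀ x, Module ℝ (E x)]
  [∀ x, TopologicalSpace (E x)] [TopologicalSpace (TotalSpace F E)]
  [FiberBundle F E] [VectorBundle ℝ F E] {A : LieAlgebroid (simplexModel k) F E} {p : ℕ}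

theorem LieAlgebroid.mem_restrictFiber {α : Finset (Fin (k + 1))} {x : canonicalSimplex k}
    {u : E x} : u ∈ A.restrictFiber α x ↔
      A.anchorVec x u ∈ vectorSpan ℝ (simplexVertex k '' (α : Set (Fin (k + 1)))) :=
  Iff.rfl

open scoped Classical in
/-- A (not necessarily smooth) extension of a form on `A^!!_α` to all fibres of `A`. -/
def SmoothFaceForm.extend {α : Finset (Fin (k + 1))} (η : SmoothFaceForm A p α)
    (x : canonicalSimplex k) : E x [⋀^Fin p]→ₗ[ℝ] ℝ :=
  if h : x ∈ simplexFace α then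
    (η.toFun ⟨x, h⟩).compLinearMap
      ((A.restrictFiber α x).subtype.exists_leftInverse_of_injective
        (A.restrictFiber α x).ker_subtype).choose
  else 0

theorem SmoothFaceForm.extend_apply {α : Finset (Fin (k + 1))} (η : SmoothFaceForm A p α)
    {x : canonicalSimplex k} (hx : x ∈ simplexFace α) (u : Fin p → A.restrictFiber α x) :
    η.extend x (fun i => (u i : E x)) = η.toFun ⟨x, hx⟩ u := by
  rw [extend, dif_pos hx, AlternatingMap.compLinearMap_apply]
  congr 1
  ext1 i
  exact LinearMap.congr_fun ((A.restrictFiber α x).subtype.exists_leftInverse_of_injective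
        (A.restrictFiber α x).ker_subtype).choose_spec (u i)

/-- A section that is tangent to the face only over `U ∩ α` becomes admissible once it is replaced
by zero wherever it leaves `A^!!_α`. -/
theorem SmoothFaceForm.contMDiffOn_extend {α : Finset (Fin (k + 1))} (η : SmoothFaceForm A p α)
    {U : Set (canonicalSimplex k)} (hU : IsOpen U) (s : Fin p → ∀ x, E x)
    (hs : ∀ i, ∀ x ∈ U ∩ simplexFace α, s i x ∈ A.restrictFiber α x)
    (hsm : ∀ i, ContMDiffOn (simplexModel k) ((simplexModel k).prod 𝓘(ℝ, F)) ∞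
      (fun x => (⟨x, s i x⟩ : TotalSpace F E)) (U ∩ simplexFace α)) :
    ContMDiffOn (simplexModel k) 𝓘(ℝ, ℝ) ∞ (fun x => η.extend x (fun i => s i x))
      (U ∩ simplexFace α) := by
  classical
  let t : Fin p → ∀ x, A.restrictFiber α x := fun i x =>
    if h : s i x ∈ A.restrictFiber α x then ⟨s i x, h⟩ else 0
  have ht : ∀ i, ∀ x ∈ U ∩ simplexFace α, (t i x : E x) = s i x := by
    intro i x hx
    simp [t, hs i x hx]
  refine η.smooth U hU t (fun i => (hsm i).congr fun x hx => by rw [ht i x hx]) _ ?_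
  intro x hx
  rw [← η.extend_apply x.2]
  congr 1
  ext1 i
  exact (ht i x ⟨hx, x.2⟩).symm

namespace AnchorFrame

variable {L : Submodule ℝ F} {U : Set (canonicalSimplex k)}

/-- The pullback of a form along a simplicial map, lifted to `A` through a frame. -/
def pullback (Φ : AnchorFrame A L U) (r : Fin (k + 1) → Fin (k + 1))
    (θ : ∀ x, E x [⋀^Fin p]→ₗ[ℝ] ℝ) (x : canonicalSimplex k) : E x [⋀^Fin p]→ₗ[ℝ] ℝ :=
  (θ (simplicialMap r x)).compLinearMap
    (Φ.vec (simplicialMap r x) ∘ₗ (vertexMap r).linear.prodMap LinearMap.id ∘ₗ Φ.coord x)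

theorem pullback_congr (Φ : AnchorFrame A L U) {r r' : Fin (k + 1) → Fin (k + 1)}
    {α : Finset (Fin (k + 1))} (hr : EqOn r r' α) (θ : ∀ x, E x [⋀^Fin p]→ₗ[ℝ] ℝ)
    {x : canonicalSimplex k} (hxU : x ∈ U) (hx : x ∈ simplexFace α) {u : Fin p → E x}
    (hu : ∀ i, u i ∈ A.restrictFiber α x) :
    Φ.pullback r θ x u = Φ.pullback r' θ x u := by
  -- The fibre depends on the base point. With the frame coordinates as arguments, base point and
  -- vectors can be replaced independently.
  let G (z : canonicalSimplex k) (w : Fin p → (Fin k → ℝ) × L) : ℝ := θ z fun i => Φ.vec z (w i)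
  have h1 : simplicialMap r x = simplicialMap r' x := Subtype.ext (vertexMap_eqOn hr hx)
  have h2 : (fun i => (vertexMap r).linear.prodMap LinearMap.id (Φ.coord x (u i))) =
      fun i => (vertexMap r').linear.prodMap LinearMap.id (Φ.coord x (u i)) := by
    ext1 i
    refine Prod.ext (vertexMap_linear_eqOn hr ?_) rfl
    rw [LinearMap.fst_apply, Φ.coord_fst x hxU]
    exact hu i
  exact congrArg₂ G h1 h2

theorem pullback_id (Φ : AnchorFrame A L U) (θ : ∀ x, E x [⋀^Fin p]→ₗ[ℝ] ℝ)
    {x : canonicalSimplex k} (hxU : x ∈ U) (u : Fin p → E x) :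
    Φ.pullback id θ x u = θ x u := by
  let G (z : canonicalSimplex k) (w : Fin p → (Fin k → ℝ) × L) : ℝ := θ z fun i => Φ.vec z (w i)
  have h1 : simplicialMap id x = x := Subtype.ext (vertexMap_id _)
  have h2 : (fun i => (vertexMap id).linear.prodMap LinearMap.id (Φ.coord x (u i))) =
      fun i => Φ.coord x (u i) :=
    funext fun i => Prod.ext (vertexMap_id_linear _) rfl
  refine (congrArg₂ G h1 h2).trans ?_
  simp only [G, Φ.vec_coord x hxU]

/-- The lifted map sends `A^!!_α` into `A^!!_β`: the frame turns the anchor into the first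
projection, and the linear part of the simplicial map sends directions of `α` to directions of `β`.
Only the restrictions of the forms to `A^!!_β` matter. -/
theorem pullback_apply_congr (Φ : AnchorFrame A L U) {r : Fin (k + 1) → Fin (k + 1)}
    {α β : Finset (Fin (k + 1))} (hr : MapsTo r α β) {θ θ' : ∀ x, E x [⋀^Fin p]→ₗ[ℝ] ℝ}
    (hθ : ∀ x ∈ simplexFace β, ∀ u : Fin p → E x, (∀ i, u i ∈ A.restrictFiber β x) →
      θ x u = θ' x u)
    {x : canonicalSimplex k} (hxU : x ∈ U) (hrx : simplicialMap r x ∈ U) (hx : x ∈ simplexFace α)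
    {u : Fin p → E x} (hu : ∀ i, u i ∈ A.restrictFiber α x) :
    Φ.pullback r θ x u = Φ.pullback r θ' x u := by
  refine hθ _ (simplicialMap_mem_face hr hx) _ fun i => ?_
  rw [LieAlgebroid.mem_restrictFiber]
  simp only [LinearMap.comp_apply]
  rw [Φ.anchor_vec hrx]
  refine vertexMap_linear_mapsTo hr ?_
  rw [LinearMap.fst_apply, Φ.coord_fst x hxU]
  exact hu i

/-- The simplicial map sends the whole simplex into `α`, so smoothness of `η` along `α` suffices.
Expand the lifted sections in a basis of (directions of `α`) × `L`: their coordinates are smooth,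
and the coefficients are values of `η` on frame vectors, which are smooth sections of `A^!!_α`,
composed with the simplicial map. -/
theorem contMDiffAt_pullback [FiniteDimensional ℝ F] (Φ : AnchorFrame A L U) (hU : IsOpen U)
    {r : Fin (k + 1) → Fin (k + 1)} {α : Finset (Fin (k + 1))} (hr : ∀ j, r j ∈ α)
    (η : SmoothFaceForm A p α) {x : canonicalSimplex k} (hxU : x ∈ U)
    (hrx : simplicialMap r x ∈ U) (s : Fin p → ∀ x, E x)
    (hs : ∀ i, ContMDiffAt (simplexModel k) ((simplexModel k).prod 𝓘(ℝ, F)) ∞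
      (fun x => (⟨x, s i x⟩ : TotalSpace F E)) x) :
    ContMDiffAt (simplexModel k) 𝓘(ℝ, ℝ) ∞
      (fun y => Φ.pullback r η.extend y (fun i => s i y)) x := by
  classical
  have hr' : MapsTo r (Finset.univ : Finset (Fin (k + 1))) α := fun j _ => hr j
  let W : Submodule ℝ ((Fin k → ℝ) × L) :=
    (vectorSpan ℝ (simplexVertex k '' (α : Set (Fin (k + 1))))).prod ⊤
  have hW : ∀ w : (Fin k → ℝ) × L, (vertexMap r).linear.prodMap LinearMap.id w ∈ W := fun w => by
    refine ⟨vertexMap_linear_mapsTo hr' ?_, trivial⟩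
    rw [Finset.coe_univ, image_univ, vectorSpan_simplexVertex_univ]
    trivial
  let R : ((Fin k → ℝ) × L) →ₗ[ℝ] W := LinearMap.codRestrict W _ hW
  let b := Module.finBasis ℝ W
  have hexp : ∀ y, Φ.pullback r η.extend y (fun i => s i y) =
      ∑ c : Fin p → Fin (Module.finrank ℝ W), (∏ i, b.coord (c i) (R (Φ.coord y (s i y)))) *
        η.extend (simplicialMap r y) (fun i => Φ.vec (simplicialMap r y) (b (c i))) := by
    intro y
    have h1 : ∀ i, (vertexMap r).linear.prodMap LinearMap.id (Φ.coord y (s i y)) =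
        ∑ c, b.coord c (R (Φ.coord y (s i y))) • (b c : (Fin k → ℝ) × L) := by
      intro i
      have := congrArg W.subtype (b.sum_repr (R (Φ.coord y (s i y))))
      rw [map_sum] at this
      exact this.symm
    simp only [pullback, AlternatingMap.compLinearMap_apply, LinearMap.comp_apply, h1, map_sum,
      map_smul]
    refine ((η.extend (simplicialMap r y)).toMultilinearMap.map_sum _).trans ?_
    refine Finset.sum_congr rfl fun c _ => ?_
    exact (η.extend (simplicialMap r y)).toMultilinearMap.map_smul_univ _ _
  simp only [hexp]
  refine ContMDiffAt.sum fun c _ => ContMDiffAt.mul (contMDiffAt_finsetProd fun i _ => ?_) ?_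
  · let l : ((Fin k → ℝ) × L) →L[ℝ] ℝ := (b.coord (c i) ∘ₗ R).toContinuousLinearMap
    exact l.contMDiff.contMDiffAt.comp x (Φ.contMDiffAt_coord (s i) x hxU (hs i))
  · have h := η.contMDiffOn_extend hU (fun i y => Φ.vec y (b (c i)))
      (fun i y hy => by
        rw [LieAlgebroid.mem_restrictFiber, Φ.anchor_vec hy.1]
        exact (b (c i)).2.1)
      (fun i => (Φ.contMDiffOn_vec _).mono inter_subset_left)
    have hface : ∀ y, simplicialMap r y ∈ simplexFace α := fun y =>
      simplicialMap_mem_face hr' (by rw [simplexFace_univ]; trivial)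
    have hN : simplicialMap r ⁻¹' U ∈ 𝓝 x :=
      (contMDiff_simplicialMap r).continuous.continuousAt.preimage_mem_nhds (hU.mem_nhds hrx)
    exact ((h _ ⟨hrx, hface x⟩).comp x (contMDiff_simplicialMap r).contMDiffAt.contMDiffWithinAt
      (fun y hy => ⟨hy, hface y⟩)).contMDiffAt hN

end AnchorFrame

end Pullback

end

noncomputable section

/-! ### Extension of piecewise smooth forms from the boundary -/

section Extension

variable {k : ℕ} {F : Type*} [NormedAddCommGroup F] [NormedSpace ℝ F]
  {E : canonicalSimplex k → Type*} [∀ x, AddCommGroup (E x)] [∀ x, Module ℝ (E x)]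
  [∀ x, TopologicalSpace (E x)] [TopologicalSpace (TotalSpace F E)]
  [FiberBundle F E] [VectorBundle ℝ F E] {A : LieAlgebroid (simplexModel k) F E} {p : ℕ}

theorem alternatingMap_sum_apply {M ι κ : Type*} [AddCommGroup M] [Module ℝ M] (s : Finset κ)
    (f : κ → M [⋀^ι]→ₗ[ℝ] ℝ) (u : ι → M) : (∑ i ∈ s, f i) u = ∑ i ∈ s, f i u := by
  classical
  induction s using Finset.induction_on with
  | empty => simp
  | insert a s ha ih => rw [Finset.sum_insert ha, Finset.sum_insert ha, AlternatingMap.add_apply, ih]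

theorem PiecewiseSmoothForm.extend_eq_extend {K : PreAbstractSimplicialComplex (Fin (k + 1))}
    (ξ : PiecewiseSmoothForm A p K) {α β : Finset (Fin (k + 1))} (hα : α ∈ K) (hβ : β ∈ K)
    (h : α ⊆ β) {x : canonicalSimplex k} (hx : x ∈ simplexFace α) {u : Fin p → E x}
    (hu : ∀ i, u i ∈ A.restrictFiber α x) :
    (ξ.form α hα).extend x u = (ξ.form β hβ).extend x u := by
  have h1 := (ξ.form α hα).extend_apply hx fun i => ⟨u i, hu i⟩
  have h2 := (ξ.form β hβ).extend_apply (simplexFace_mono h hx)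
    fun i => ⟨u i, A.restrictFiber_mono h x (hu i)⟩
  exact h1.trans ((ξ.compatible α β hα hβ h ⟨x, hx⟩ _).trans h2.symm)

open scoped Classical in
/-- The forms of a piecewise smooth form, extended to all fibres of `A`, and by zero to the faces
outside of the complex. -/
def PiecewiseSmoothForm.extend {K : PreAbstractSimplicialComplex (Fin (k + 1))}
    (ξ : PiecewiseSmoothForm A p K) (α : Finset (Fin (k + 1))) (x : canonicalSimplex k) :
    E x [⋀^Fin p]→ₗ[ℝ] ℝ :=
  if hα : α ∈ K then (ξ.form α hα).extend x else 0

theorem PiecewiseSmoothForm.extend_of_mem {K : PreAbstractSimplicialComplex (Fin (k + 1))}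
    (ξ : PiecewiseSmoothForm A p K) {α : Finset (Fin (k + 1))} (hα : α ∈ K) :
    ξ.extend α = (ξ.form α hα).extend :=
  funext fun _ => dif_pos hα

theorem PiecewiseSmoothForm.extend_of_notMem {K : PreAbstractSimplicialComplex (Fin (k + 1))}
    (ξ : PiecewiseSmoothForm A p K) {α : Finset (Fin (k + 1))} (hα : α ∉ K) :
    ξ.extend α = 0 :=
  funext fun _ => dif_neg hα

/-- The map on vertices that collapses `S` to `i₀`. -/
def collapse {k : ℕ} (i₀ : Fin (k + 1)) (S : Finset (Fin (k + 1))) (j : Fin (k + 1)) :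
    Fin (k + 1) :=
  if j ∈ S then i₀ else j

/-- The alternating sum of the pullbacks of the forms on the faces opposite to the nonempty
subsets `S` of `J`, along the simplicial maps that collapse `S` to `i₀`. -/
def AnchorFrame.boundaryExtension {L : Submodule ℝ F} {U : Set (canonicalSimplex k)}
    (Φ : AnchorFrame A L U) (ξ : PiecewiseSmoothForm A p (boundaryComplex k))
    (i₀ : Fin (k + 1)) (J : Finset (Fin (k + 1))) (x : canonicalSimplex k) :
    E x [⋀^Fin p]→ₗ[ℝ] ℝ :=
  -∑ S ∈ J.powerset, (-1 : ℝ) ^ S.card • Φ.pullback (collapse i₀ S) (ξ.extend Sᶜ) x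

theorem compl_mem_boundaryComplex {i₀ : Fin (k + 1)} {S : Finset (Fin (k + 1))} (hi₀ : i₀ ∉ S)
    (hS : S.Nonempty) : Sᶜ ∈ boundaryComplex k :=
  ⟨⟨i₀, Finset.mem_compl.2 hi₀⟩, fun h => hS.ne_empty (Finset.compl_eq_univ_iff _ |>.1 h)⟩

theorem univ_notMem_boundaryComplex : Finset.univ ∉ boundaryComplex k :=
  fun h => h.2 rfl

namespace AnchorFrame

variable {L : Submodule ℝ F} {U : Set (canonicalSimplex k)}

theorem contMDiffAt_boundaryExtension [FiniteDimensional ℝ F] (Φ : AnchorFrame A L U)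
    (hU : IsOpen U) (ξ : PiecewiseSmoothForm A p (boundaryComplex k))
    {i₀ : Fin (k + 1)} {J : Finset (Fin (k + 1))} (hi₀ : i₀ ∉ J) {x : canonicalSimplex k}
    (hx : ∀ S ⊆ J, simplicialMap (collapse i₀ S) x ∈ U) (hxU : x ∈ U) (s : Fin p → ∀ x, E x)
    (hs : ∀ i, ContMDiffAt (simplexModel k) ((simplexModel k).prod 𝓘(ℝ, F)) ∞
      (fun x => (⟨x, s i x⟩ : TotalSpace F E)) x) :
    ContMDiffAt (simplexModel k) 𝓘(ℝ, ℝ) ∞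
      (fun y => Φ.boundaryExtension ξ i₀ J y (fun i => s i y)) x := by
  simp only [boundaryExtension, AlternatingMap.neg_apply, alternatingMap_sum_apply,
    AlternatingMap.smul_apply, smul_eq_mul]
  refine (ContMDiffAt.sum fun S hS => contMDiffAt_const.mul ?_).neg
  have hSJ := Finset.mem_powerset.1 hS
  obtain rfl | hne := S.eq_empty_or_nonempty
  -- The term `S = ∅` belongs to the whole simplex, where `ξ` has been extended by zero.
  · rw [Finset.compl_empty, ξ.extend_of_notMem univ_notMem_boundaryComplex]
    exact contMDiffAt_const (c := (0 : ℝ))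
  · have hi : i₀ ∉ S := fun h => hi₀ (hSJ h)
    rw [ξ.extend_of_mem (compl_mem_boundaryComplex hi hne)]
    refine Φ.contMDiffAt_pullback hU (fun j => ?_) _ hxU (hx S hSJ) s hs
    rw [collapse]
    split_ifs with h <;> simpa

theorem boundaryExtension_apply (Φ : AnchorFrame A L U)
    (ξ : PiecewiseSmoothForm A p (boundaryComplex k))
    {i₀ : Fin (k + 1)} {J : Finset (Fin (k + 1))} (hi₀ : i₀ ∉ J) {x : canonicalSimplex k}
    (hx : ∀ S ⊆ J, simplicialMap (collapse i₀ S) x ∈ U) (hxU : x ∈ U)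
    {β : Finset (Fin (k + 1))} (hβ : β ∈ boundaryComplex k) (hxβ : x ∈ simplexFace β)
    {j : Fin (k + 1)} (hj : j ∈ J) (hjβ : j ∉ β) {u : Fin p → E x}
    (hu : ∀ i, u i ∈ A.restrictFiber β x) :
    Φ.boundaryExtension ξ i₀ J x u = (ξ.form β hβ).extend x u := by
  let f (S : Finset (Fin (k + 1))) : ℝ := Φ.pullback (collapse i₀ S) (ξ.extend Sᶜ) x u
  have hf : Φ.boundaryExtension ξ i₀ J x u = -∑ S ∈ J.powerset, (-1 : ℝ) ^ S.card * f S := by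
    simp only [boundaryExtension, AlternatingMap.neg_apply, alternatingMap_sum_apply,
      AlternatingMap.smul_apply, smul_eq_mul, f]
  -- Since `j ∉ β`, both collapses agree on `β` and send it into the face opposite to `S ∪ {j}`,
  -- where the two forms agree by compatibility.
  have hins : ∀ S ⊆ J, S.Nonempty → f (insert j S) = f S := by
    intro S hSJ hne
    have hi : i₀ ∉ S := fun h => hi₀ (hSJ h)
    have hi' : i₀ ∉ insert j S := fun h => hi₀ (Finset.insert_subset hj hSJ h)
    have hc := compl_mem_boundaryComplex hi hne
    have hc' := compl_mem_boundaryComplex hi' (Finset.insert_nonempty j S)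
    refine (Φ.pullback_congr (r' := collapse i₀ S) (fun i hi => ?_) _ hxU hxβ hu).trans
      (Φ.pullback_apply_congr (β := (insert j S)ᶜ) (fun i hi => ?_) (fun y hy v hv => ?_) hxU
        (hx S hSJ) hxβ hu)
    · have hij : i ≠ j := fun h => hjβ (h ▸ hi)
      simp [collapse, hij]
    · have hij : i ≠ j := fun h => hjβ (h ▸ hi)
      rw [collapse, Finset.mem_coe, Finset.mem_compl]
      split_ifs with h
      · exact hi'
      · simp [hij, h]
    · rw [ξ.extend_of_mem hc, ξ.extend_of_mem hc']
      exact ξ.extend_eq_extend hc' hc (Finset.compl_subset_compl.2 (Finset.subset_insert j S)) hy hv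
  have hempty : f ∅ = 0 := by
    simp only [f, Finset.compl_empty, ξ.extend_of_notMem univ_notMem_boundaryComplex]
    rfl
  -- Collapsing `j` alone is the identity on `β`, and `β` lies in the face opposite to `j`.
  have hsingle : f (insert j ∅) = (ξ.form β hβ).extend x u := by
    have hc : (insert j ∅ : Finset (Fin (k + 1)))ᶜ ∈ boundaryComplex k :=
      compl_mem_boundaryComplex (i₀ := i₀) (fun h => hi₀ (by simp at h; exact h ▸ hj))
        (Finset.insert_nonempty j ∅)
    refine (Φ.pullback_congr (r' := id) (fun i hi => ?_) _ hxU hxβ hu).trans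
      ((Φ.pullback_id _ hxU u).trans ?_)
    · have hij : i ≠ j := fun h => hjβ (h ▸ hi)
      simp [collapse, hij]
    · rw [ξ.extend_of_mem hc]
      refine (ξ.extend_eq_extend hβ hc (fun i hi => ?_) hxβ hu).symm
      have hij : i ≠ j := fun h => hjβ (h ▸ hi)
      simpa using hij
  -- Pair each `S` not containing `j` with `S ∪ {j}`: the signs are opposite, so only the pair of
  -- `∅` contributes.
  have hJ : J = insert j (J.erase j) := (Finset.insert_erase hj).symm
  rw [hf, hJ, Finset.sum_powerset_insert (Finset.notMem_erase j J), ← Finset.sum_add_distrib,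
    Finset.sum_eq_single ∅, hempty, hsingle]
  · simp
  · intro S hS hne
    have hSJ := Finset.mem_powerset.1 hS
    rw [hins S (hSJ.trans (Finset.erase_subset j J)) (Finset.nonempty_iff_ne_empty.2 hne),
      Finset.card_insert_of_notMem fun h => Finset.notMem_erase j J (hSJ h)]
    ring
  · exact fun h => absurd (Finset.empty_mem_powerset _) h

end AnchorFrame

theorem exists_local_extension [FiniteDimensional ℝ F]
    [ContMDiffVectorBundle ∞ F E (simplexModel k)] (hA : A.IsTransitive)
    (ξ : PiecewiseSmoothForm A p (boundaryComplex k)) (x₀ : canonicalSimplex k) :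
    ∃ (V : Set (canonicalSimplex k)) (θ : ∀ x, E x [⋀^Fin p]→ₗ[ℝ] ℝ), IsOpen V ∧ x₀ ∈ V ∧
      (∀ x ∈ V, ∀ s : Fin p → ∀ x, E x,
        (∀ i, ContMDiffAt (simplexModel k) ((simplexModel k).prod 𝓘(ℝ, F)) ∞
          (fun x => (⟨x, s i x⟩ : TotalSpace F E)) x) →
        ContMDiffAt (simplexModel k) 𝓘(ℝ, ℝ) ∞ (fun y => θ y (fun i => s i y)) x) ∧
      ∀ β (hβ : β ∈ boundaryComplex k), ∀ x ∈ V ∩ simplexFace β, ∀ u : Fin p → E x,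
        (∀ i, u i ∈ A.restrictFiber β x) → θ x u = (ξ.form β hβ).extend x u := by
  obtain ⟨L, U, hU, hxU, ⟨Φ⟩⟩ := exists_anchorFrame A hA x₀
  let J : Finset (Fin (k + 1)) := {j | baryCoord (x₀ : Fin k → ℝ) j = 0}
  obtain ⟨i₀, hi₀⟩ : ∃ i₀, i₀ ∉ J := by
    by_contra! h
    have h1 := sum_baryCoord (x₀ : Fin k → ℝ)
    rw [Finset.sum_eq_zero fun j _ => (Finset.mem_filter.1 (h j)).2] at h1
    exact zero_ne_one h1
  -- Collapsing only moves vertices that carry zero weight at `x₀`.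
  have hfix : ∀ S ⊆ J, simplicialMap (collapse i₀ S) x₀ = x₀ := by
    intro S hS
    refine Subtype.ext (Eq.trans ?_ (vertexMap_id (x₀ : Fin k → ℝ)))
    simp only [simplicialMap, vertexMap_apply, id]
    refine Finset.sum_congr rfl fun j _ => ?_
    by_cases hj : j ∈ S
    · rw [(Finset.mem_filter.1 (hS hj)).2, zero_smul, zero_smul]
    · simp [collapse, hj]
  -- The last condition makes every face that meets `V` contain `x₀`. Any vertex missing from such a
  -- face then has zero weight at `x₀`, so it lies in `J`.
  have hev : ∀ᶠ x in 𝓝 x₀, x ∈ U ∧ (∀ S ⊆ J, simplicialMap (collapse i₀ S) x ∈ U) ∧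
      ∀ β : Finset (Fin (k + 1)), x₀ ∉ simplexFace β → x ∉ simplexFace β := by
    refine Filter.Eventually.and (hU.mem_nhds hxU) (Filter.Eventually.and ?_ ?_)
    · refine Filter.eventually_all.2 fun S => Filter.eventually_imp_distrib_left.2 fun hS => ?_
      refine (contMDiff_simplicialMap _).continuous.continuousAt.eventually_mem (hU.mem_nhds ?_)
      rwa [hfix S hS]
    · refine Filter.eventually_all.2 fun β => Filter.eventually_imp_distrib_left.2 fun hβ => ?_
      exact (isClosed_simplexFace β).isOpen_compl.mem_nhds hβ
  obtain ⟨V, hVsub, hV, hxV⟩ := mem_nhds_iff.1 hev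
  refine ⟨V, Φ.boundaryExtension ξ i₀ J, hV, hxV, fun x hx s hs => ?_, fun β hβ x hx u hu => ?_⟩
  · exact Φ.contMDiffAt_boundaryExtension hU ξ hi₀ (hVsub hx).2.1 (hVsub hx).1 s hs
  · have hx₀β : x₀ ∈ simplexFace β := by
      by_contra h
      exact (hVsub hx.1).2.2 β h hx.2
    obtain ⟨j, hj⟩ : ∃ j, j ∉ β := by
      by_contra! h
      exact hβ.2 (Finset.eq_univ_iff_forall.2 h)
    exact Φ.boundaryExtension_apply ξ hi₀ (hVsub hx.1).2.1 (hVsub hx.1).1 hβ hx.2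
      (Finset.mem_filter.2 ⟨Finset.mem_univ j, baryCoord_eq_zero hx₀β hj⟩) hj hu

/-- Weights of a partition of unity sum to one, so an average of local forms with the prescribed
boundary values keeps those values. -/
theorem exists_extension [FiniteDimensional ℝ F]
    [ContMDiffVectorBundle ∞ F E (simplexModel k)] (hA : A.IsTransitive)
    (ξ : PiecewiseSmoothForm A p (boundaryComplex k)) :
    ∃ θ : ∀ x, E x [⋀^Fin p]→ₗ[ℝ] ℝ,
      (∀ x, ∀ s : Fin p → ∀ x, E x,
        (∀ i, ContMDiffAt (simplexModel k) ((simplexModel k).prod 𝓘(ℝ, F)) ∞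
          (fun x => (⟨x, s i x⟩ : TotalSpace F E)) x) →
        ContMDiffAt (simplexModel k) 𝓘(ℝ, ℝ) ∞ (fun y => θ y (fun i => s i y)) x) ∧
      ∀ β (hβ : β ∈ boundaryComplex k), ∀ x ∈ simplexFace β, ∀ u : Fin p → E x,
        (∀ i, u i ∈ A.restrictFiber β x) → θ x u = (ξ.form β hβ).extend x u := by
  choose V θ hV hxV hsmooth hext using exists_local_extension hA ξ
  have : CompactSpace (canonicalSimplex k) :=
    isCompact_iff_compactSpace.1 ((finite_range (simplexVertex k)).isCompact_convexHull ℝ)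
  obtain ⟨ρ, hρ⟩ := SmoothPartitionOfUnity.exists_isSubordinate (simplexModel k) isClosed_univ V hV
    fun x _ => mem_iUnion.2 ⟨x, hxV x⟩
  refine ⟨fun x => ∑ i ∈ ρ.finsupport x, ρ i x • θ i x, fun x s hs => ?_, fun β hβ x hx u hu => ?_⟩
  · have h := ρ.contMDiffAt_finsum (n := (⊤ : ℕ∞)) (x₀ := x) (g := fun i y => θ i y (fun l => s l y))
      fun i hi => hsmooth i x (hρ i hi) s hs
    refine h.congr_of_eventuallyEq (Filter.Eventually.of_forall fun y => ?_)
    simp only [alternatingMap_sum_apply, AlternatingMap.smul_apply]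
    exact ρ.sum_finsupport_smul_eq_finsum y fun i y => θ i y (fun l => s l y)
  · simp only [alternatingMap_sum_apply, AlternatingMap.smul_apply]
    have h : ∀ i ∈ ρ.finsupport x, ρ i x • θ i x u = ρ i x • (ξ.form β hβ).extend x u := by
      intro i hi
      rw [ρ.mem_finsupport] at hi
      rw [hext i β hβ x ⟨hρ i (subset_tsupport _ hi), hx⟩ u hu]
    rw [Finset.sum_congr rfl h, ← Finset.sum_smul, ρ.sum_finsupport x (mem_univ x), one_smul]

end Extension

end

theorem proposition3p1 (k : ℕ)
    {F : Type*} [NormedAddCommGroup F] [NormedSpace ℝ F] [FiniteDimensional ℝ F]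
    {E : canonicalSimplex k → Type*} [∀ x, AddCommGroup (E x)] [∀ x, Module ℝ (E x)]
    [∀ x, TopologicalSpace (E x)] [TopologicalSpace (TotalSpace F E)]
    [FiberBundle F E] [VectorBundle ℝ F E] [ContMDiffVectorBundle ∞ F E (simplexModel k)]
    (A : LieAlgebroid (simplexModel k) F E) (hA : A.IsTransitive)
    (p : ℕ) (ξ : PiecewiseSmoothForm A p (boundaryComplex k)) :
    ∃ η : PiecewiseSmoothForm A p (⊤ : PreAbstractSimplicialComplex (Fin (k + 1))),
      η.restrict (le_top : boundaryComplex k ≤ ⊤) = ξ := by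
  obtain ⟨θ, hsmooth, hext⟩ := exists_extension hA ξ
  have hξ : ∀ β (hβ : β ∈ boundaryComplex k) (x : simplexFace β) (u : Fin p → A.restrictFiber β x),
      θ x (fun i => u i) = (ξ.form β hβ).toFun x u := fun β hβ x u =>
    (hext β hβ x x.2 _ fun i => (u i).2).trans ((ξ.form β hβ).extend_apply x.2 u)
  refine ⟨⟨fun α hα => ⟨fun x => (θ x).compLinearMap (A.restrictFiber α x).subtype, ?_⟩,
    fun α β hα hβ h x u => rfl⟩, ?_⟩
  · intro U hU s hs g hg
    -- On the top face, sections over `U` are smooth on an open set and `θ` can be tested on them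
    -- directly. On a proper face the form equals `ξ_α` and inherits its smoothness, so no section
    -- has to be extended off the face.
    by_cases hαu : α = Finset.univ
    · subst hαu
      rw [simplexFace_univ, inter_univ] at hs ⊢
      intro x hx
      have h := hsmooth x (fun i y => s i y) fun i => (hs i).contMDiffAt (hU.mem_nhds hx)
      refine (h.congr_of_eventuallyEq ?_).contMDiffWithinAt
      filter_upwards [hU.mem_nhds hx] with y hy
      exact hg ⟨y, by rw [simplexFace_univ]; trivial⟩ hy
    · have hα' : α ∈ boundaryComplex k :=
        ⟨((⊤ : PreAbstractSimplicialComplex (Fin (k + 1))).isRelLowerSet_faces hα).1, hαu⟩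
      exact (ξ.form α hα').smooth U hU s hs g fun x hx => (hg x hx).trans (hξ α hα' x _)
  · ext α hα x u
    exact hξ α hα x u
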